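/- Let $\mathcal A$ and $\mathcal B$ be unital C*-algebras, and let $\mathcal A\otimes\mathcal B$ be their maximal tensor product, i.e. the completion of the algebraic tensor product in the norm $\|x\|_{\max}=\sup_\pi\|\pi(x)\|$, where $\pi$ runs through the unital $*$-representations of the algebraic tensor product on complex Hilbert spaces. Let $c\in\mathcal A\otimes\mathcal B$ be positive, and let $\eta$ and $\xi$ be states of $\mathcal A$ and $\mathcal B$ (positive linear functionals with $\eta(1)=1$ and $\xi(1)=1$). Let $\Gamma(\eta,\xi)$ be the set of all states $\omega$ of $\mathcal A\otimes\mathcal B$ such that $$\omega(a\otimes 1_{\mathcal B}+1_{\mathcal A}\otimes b)=\eta(a)+\xi(b)\qquad\text{for all } a\in\mathcal A,\ b\in\mathcal B,$$ and let $\tilde\Gamma(c)$ be the set of all pairs of self-adjoint elements $(a,b)\in\mathcal A\times\mathcal B$ such that $a\otimes 1_{\mathcal B}+1_{\mathcal A}\otimes b\le c$. Then $$\mathcal W_c(\eta,\xi):=\inf_{\omega\in\Gamma(\eta,\xi)}\omega(c)=\sup_{(a,b)\in\tilde\Gamma(c)}\bigl(\eta(a)+\xi(b)\bigr).$$ Both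 quantities are finite (in particular $\Gamma(\eta,\xi)\neq\emptyset$), and the infimum is attained: there is $\omega\in\Gamma(\eta,\xi)$ with $\omega(c)=\mathcal W_c(\eta,\xi)$. -/

import Mathlib

open scoped TensorProduct ComplexOrder

namespace MaxTensor

noncomputable section

universe u v

section Norm

variable {A : Type u} {B : Type v} [CStarAlgebra A] [CStarAlgebra B]

/-- The values `‖π x‖`, where `π` runs through the unital `*`-representations of the algebraic
tensor product `A ⊗ B` on complex Hilbert spaces. The universe `max u v` is large enough for the
Hilbert spaces: every cyclic representation is unitarily equivalent to one on a completion of a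
quotient of `A ⊗ B` (GNS), and the norm of `π x` is reached on cyclic subrepresentations. -/
def repNorms (x : A ⊗[ℂ] B) : Set ℝ :=
  {r | ∃ (H : Type (max u v)) (_ : NormedAddCommGroup H) (_ : InnerProductSpace ℂ H)
    (_ : CompleteSpace H) (π : A ⊗[ℂ] B →⋆ₐ[ℂ] (H →L[ℂ] H)), r = ‖π x‖}

/-- The maximal C⋆-norm on the algebraic tensor product:
`‖x‖_max = sup {‖π x‖ : π a *-representation of A ⊗ B on a Hilbert space}`. -/
def maxNorm (x : A ⊗[ℂ] B) : ℝ := sSup (repNorms x)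

theorem repNorms_nonempty (x : A ⊗[ℂ] B) : (repNorms x).Nonempty := by
  have hs : Subsingleton (PUnit.{(max u v) + 1} →L[ℂ] PUnit.{(max u v) + 1}) :=
    ⟨fun f g => by ext⟩
  let T : InnerProductSpace ℂ PUnit.{(max u v) + 1} :=
    { inner := fun _ _ => 0
      norm_sq_eq_re_inner := fun x => by simp [Subsingleton.elim x 0]
      conj_inner_symm := fun _ _ => by simp
      add_left := fun _ _ _ => by simp
      smul_left := fun _ _ _ => by simp }
  exact ⟨_, PUnit.{(max u v) + 1}, inferInstance, T, inferInstance,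
    { toFun := fun _ => 0
      map_one' := Subsingleton.elim _ _
      map_mul' := fun _ _ => Subsingleton.elim _ _
      map_zero' := rfl
      map_add' := fun _ _ => Subsingleton.elim _ _
      commutes' := fun _ => Subsingleton.elim _ _
      map_star' := fun _ => Subsingleton.elim _ _ }, rfl⟩

/-- A `*`-representation of the algebraic tensor product restricts to `*`-homomorphisms of the
factors, which are contractive. -/
theorem norm_rep_tmul_le {H : Type*} [NormedAddCommGroup H] [InnerProductSpace ℂ H]
    [CompleteSpace H] (π : A ⊗[ℂ] B →⋆ₐ[ℂ] (H →L[ℂ] H)) (a : A) (b : B) :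
    ‖π (a ⊗ₜ[ℂ] b)‖ ≤ ‖a‖ * ‖b‖ := by
  let πA : A →⋆ₐ[ℂ] (H →L[ℂ] H) :=
    { (π : A ⊗[ℂ] B →ₐ[ℂ] (H →L[ℂ] H)).comp Algebra.TensorProduct.includeLeft with
      map_star' := fun a => by
        have : (star a) ⊗ₜ[ℂ] (1 : B) = star (a ⊗ₜ[ℂ] (1 : B)) := by simp
        simp [this, -TensorProduct.star_tmul, map_star] }
  let πB : B →⋆ₐ[ℂ] (H →L[ℂ] H) :=
    { (π : A ⊗[ℂ] B →ₐ[ℂ] (H →L[ℂ] H)).comp Algebra.TensorProduct.includeRight with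
      map_star' := fun b => by
        have : (1 : A) ⊗ₜ[ℂ] (star b) = star ((1 : A) ⊗ₜ[ℂ] b) := by simp
        simp [this, -TensorProduct.star_tmul, map_star] }
  have h : π (a ⊗ₜ[ℂ] b) = πA a * πB b := by
    change _ = π (a ⊗ₜ[ℂ] 1) * π (1 ⊗ₜ[ℂ] b)
    rw [← map_mul]; simp
  rw [h]
  refine (norm_mul_le _ _).trans ?_
  gcongr
  · exact NonUnitalStarAlgHom.norm_apply_le πA a
  · exact NonUnitalStarAlgHom.norm_apply_le πB b

theorem repNorms_bddAbove (x : A ⊗[ℂ] B) : BddAbove (repNorms x) := by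
  induction x with
  | zero => exact ⟨0, by rintro r ⟨H, _, _, _, π, rfl⟩; simp⟩
  | tmul a b => exact ⟨‖a‖ * ‖b‖, by rintro r ⟨H, _, _, _, π, rfl⟩; exact norm_rep_tmul_le π a b⟩
  | add x y hx hy =>
    obtain ⟨C, hC⟩ := hx
    obtain ⟨D, hD⟩ := hy
    refine ⟨C + D, ?_⟩
    rintro r ⟨H, _, _, _, π, rfl⟩
    rw [map_add]
    exact (norm_add_le _ _).trans
      (add_le_add (hC ⟨H, _, _, _, π, rfl⟩) (hD ⟨H, _, _, _, π, rfl⟩))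

theorem norm_rep_le {H : Type (max u v)} [NormedAddCommGroup H] [InnerProductSpace ℂ H]
    [CompleteSpace H] (π : A ⊗[ℂ] B →⋆ₐ[ℂ] (H →L[ℂ] H)) (x : A ⊗[ℂ] B) : ‖π x‖ ≤ maxNorm x :=
  le_csSup (repNorms_bddAbove x) ⟨H, _, _, _, π, rfl⟩

theorem maxNorm_le {x : A ⊗[ℂ] B} {C : ℝ}
    (h : ∀ (H : Type (max u v)) [NormedAddCommGroup H] [InnerProductSpace ℂ H] [CompleteSpace H]
      (π : A ⊗[ℂ] B →⋆ₐ[ℂ] (H →L[ℂ] H)), ‖π x‖ ≤ C) : maxNorm x ≤ C :=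
  csSup_le (repNorms_nonempty x) (by rintro r ⟨H, _, _, _, π, rfl⟩; exact h H π)

theorem maxNorm_nonneg (x : A ⊗[ℂ] B) : 0 ≤ maxNorm x :=
  Real.sSup_nonneg (by rintro r ⟨H, _, _, _, π, rfl⟩; exact norm_nonneg _)

theorem maxNorm_zero : maxNorm (0 : A ⊗[ℂ] B) = 0 :=
  le_antisymm (maxNorm_le fun H _ _ _ π => by simp) (maxNorm_nonneg _)

theorem maxNorm_add_le (x y : A ⊗[ℂ] B) : maxNorm (x + y) ≤ maxNorm x + maxNorm y :=
  maxNorm_le fun H _ _ _ π => by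
    rw [map_add]
    exact (norm_add_le _ _).trans (add_le_add (norm_rep_le π x) (norm_rep_le π y))

theorem maxNorm_neg (x : A ⊗[ℂ] B) : maxNorm (-x) = maxNorm x := by
  simp [maxNorm, repNorms]

theorem maxNorm_mul_le (x y : A ⊗[ℂ] B) : maxNorm (x * y) ≤ maxNorm x * maxNorm y :=
  maxNorm_le fun H _ _ _ π => by
    rw [map_mul]
    exact (norm_mul_le _ _).trans
      (mul_le_mul (norm_rep_le π x) (norm_rep_le π y) (norm_nonneg _) (maxNorm_nonneg _))

theorem maxNorm_smul_le (c : ℂ) (x : A ⊗[ℂ] B) : maxNorm (c • x) ≤ ‖c‖ * maxNorm x :=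
  maxNorm_le fun H _ _ _ π => by
    rw [map_smul, norm_smul]
    exact mul_le_mul_of_nonneg_left (norm_rep_le π x) (norm_nonneg _)

theorem maxNorm_star (x : A ⊗[ℂ] B) : maxNorm (star x) = maxNorm x := by
  simp [maxNorm, repNorms, map_star]

theorem maxNorm_mul_self_le (x : A ⊗[ℂ] B) : maxNorm x * maxNorm x ≤ maxNorm (star x * x) := by
  have h : maxNorm x ≤ Real.sqrt (maxNorm (star x * x)) := maxNorm_le fun H _ _ _ π => by
    refine Real.le_sqrt_of_sq_le ?_
    have := norm_rep_le π (star x * x)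
    rwa [map_mul, map_star, CStarRing.norm_star_mul_self, ← sq] at this
  calc maxNorm x * maxNorm x
      ≤ Real.sqrt (maxNorm (star x * x)) * Real.sqrt (maxNorm (star x * x)) :=
        mul_self_le_mul_self (maxNorm_nonneg x) h
    _ = _ := Real.mul_self_sqrt (maxNorm_nonneg _)

end Norm

section Completion

variable (A : Type u) (B : Type v) [CStarAlgebra A] [CStarAlgebra B]

/-- The algebraic tensor product `A ⊗ B`, as a type to carry the maximal C⋆-norm. -/
def AlgTensor : Type (max u v) := A ⊗[ℂ] B

instance : Ring (AlgTensor A B) := inferInstanceAs (Ring (A ⊗[ℂ] B))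
instance : Algebra ℂ (AlgTensor A B) := inferInstanceAs (Algebra ℂ (A ⊗[ℂ] B))
instance : StarRing (AlgTensor A B) := inferInstanceAs (StarRing (A ⊗[ℂ] B))
instance : StarModule ℂ (AlgTensor A B) := inferInstanceAs (StarModule ℂ (A ⊗[ℂ] B))

instance : SeminormedRing (AlgTensor A B) :=
  RingSeminorm.toSeminormedRing
    { toFun := fun x : A ⊗[ℂ] B => maxNorm x
      map_zero' := maxNorm_zero
      add_le' := maxNorm_add_le
      neg' := maxNorm_neg
      mul_le' := maxNorm_mul_le }

instance : NormedAlgebra ℂ (AlgTensor A B) where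
  norm_smul_le c x := maxNorm_smul_le (A := A) (B := B) c x

instance : NormedStarGroup (AlgTensor A B) where
  norm_star_le x := (maxNorm_star (A := A) (B := B) x).le

/-- The maximal tensor product of two unital C⋆-algebras: the completion of the algebraic tensor
product in the maximal C⋆-norm. -/
def MaxTensorProduct : Type (max u v) := UniformSpace.Completion (AlgTensor A B)

instance : NormedRing (MaxTensorProduct A B) :=
  inferInstanceAs (NormedRing (UniformSpace.Completion (AlgTensor A B)))

instance : CompleteSpace (MaxTensorProduct A B) :=
  inferInstanceAs (CompleteSpace (UniformSpace.Completion (AlgTensor A B)))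

instance : Algebra ℂ (MaxTensorProduct A B) :=
  inferInstanceAs (Algebra ℂ (UniformSpace.Completion (AlgTensor A B)))

instance : NormedAlgebra ℂ (MaxTensorProduct A B) where
  norm_smul_le := fun c (x : UniformSpace.Completion (AlgTensor A B)) => norm_smul_le c x

variable {A B}

/-- The canonical map from the algebraic to the maximal tensor product. -/
def ofAlg (x : A ⊗[ℂ] B) : MaxTensorProduct A B :=
  ((show AlgTensor A B from x : AlgTensor A B) : UniformSpace.Completion (AlgTensor A B))

theorem norm_ofAlg (x : A ⊗[ℂ] B) : ‖ofAlg x‖ = maxNorm x :=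
  UniformSpace.Completion.norm_coe (E := AlgTensor A B) x

theorem ofAlg_add (x y : A ⊗[ℂ] B) : ofAlg (x + y) = ofAlg x + ofAlg y :=
  UniformSpace.Completion.coe_add (α := AlgTensor A B) x y

theorem ofAlg_mul (x y : A ⊗[ℂ] B) : ofAlg (x * y) = ofAlg x * ofAlg y :=
  UniformSpace.Completion.coe_mul (α := AlgTensor A B) x y

theorem ofAlg_one : ofAlg (1 : A ⊗[ℂ] B) = 1 := rfl

theorem ofAlg_smul (c : ℂ) (x : A ⊗[ℂ] B) : ofAlg (c • x) = c • ofAlg x :=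
  UniformSpace.Completion.coe_smul (X := AlgTensor A B) c x

theorem denseRange_ofAlg : DenseRange (ofAlg : A ⊗[ℂ] B → MaxTensorProduct A B) :=
  UniformSpace.Completion.denseRange_coe (α := AlgTensor A B)

theorem induction_ofAlg {p : MaxTensorProduct A B → Prop} (x : MaxTensorProduct A B)
    (hp : IsClosed {x | p x}) (h : ∀ y : A ⊗[ℂ] B, p (ofAlg y)) : p x :=
  UniformSpace.Completion.induction_on (α := AlgTensor A B) x hp h

theorem induction_ofAlg₂ {p : MaxTensorProduct A B → MaxTensorProduct A B → Prop}
    (x y : MaxTensorProduct A B)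
    (hp : IsClosed {z : MaxTensorProduct A B × MaxTensorProduct A B | p z.1 z.2})
    (h : ∀ x y : A ⊗[ℂ] B, p (ofAlg x) (ofAlg y)) : p x y :=
  UniformSpace.Completion.induction_on₂ (α := AlgTensor A B) (β := AlgTensor A B) x y hp h

/-- The involution of the maximal tensor product: the continuous extension of the involution of
the algebraic tensor product. -/
instance : Star (MaxTensorProduct A B) where
  star := UniformSpace.Completion.map (star : AlgTensor A B → AlgTensor A B)

theorem continuous_star_max : Continuous (star : MaxTensorProduct A B → MaxTensorProduct A B) :=
  UniformSpace.Completion.continuous_map (f := (star : AlgTensor A B → AlgTensor A B))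

theorem star_ofAlg (x : A ⊗[ℂ] B) : star (ofAlg x) = ofAlg (star x) :=
  UniformSpace.Completion.map_coe (f := (star : AlgTensor A B → AlgTensor A B))
    (starNormedAddGroupHom (E := AlgTensor A B)).uniformContinuous x

instance : StarRing (MaxTensorProduct A B) where
  star_involutive x := by
    induction x using induction_ofAlg with
    | hp => exact isClosed_eq (continuous_star_max.comp continuous_star_max) continuous_id
    | h x => simp only [star_ofAlg, star_star]
  star_mul x y := by
    induction x, y using induction_ofAlg₂ with
    | hp => exact isClosed_eq (continuous_star_max.comp (continuous_fst.mul continuous_snd))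
              ((continuous_star_max.comp continuous_snd).mul
                (continuous_star_max.comp continuous_fst))
    | h x y => simp only [star_ofAlg, ← ofAlg_mul, star_mul]
  star_add x y := by
    induction x, y using induction_ofAlg₂ with
    | hp => exact isClosed_eq (continuous_star_max.comp (continuous_fst.add continuous_snd))
              ((continuous_star_max.comp continuous_fst).add
                (continuous_star_max.comp continuous_snd))
    | h x y => simp only [star_ofAlg, ← ofAlg_add, star_add]

instance : CStarAlgebra (MaxTensorProduct A B) where
  norm_mul_self_le x := by
    induction x using induction_ofAlg with
    | hp => exact isClosed_le (continuous_norm.mul continuous_norm)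
              (continuous_norm.comp (continuous_star_max.mul continuous_id))
    | h x => simpa only [star_ofAlg, ← ofAlg_mul, norm_ofAlg] using maxNorm_mul_self_le x
  star_smul c x := by
    induction x using induction_ofAlg with
    | hp => exact isClosed_eq (continuous_star_max.comp (continuous_const_smul c))
              ((continuous_const_smul (star c)).comp continuous_star_max)
    | h x => simp only [star_ofAlg, ← ofAlg_smul, star_smul]

/-- The usual order of a C⋆-algebra: `x ≤ y` if and only if `y - x` is self-adjoint with
nonnegative spectrum, that is, of the form `star z * z`. -/
instance : PartialOrder (MaxTensorProduct A B) := CStarAlgebra.spectralOrder _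

instance : StarOrderedRing (MaxTensorProduct A B) := CStarAlgebra.spectralOrderedRing _

/-- The elementary tensor `a ⊗ b` in the maximal tensor product. -/
def tmul (a : A) (b : B) : MaxTensorProduct A B := ofAlg (a ⊗ₜ[ℂ] b)

end Completion

section Transport

/-- The states of a unital C⋆-algebra: the positive linear functionals with value `1` at `1`. -/
def stateSpace (A : Type u) [CStarAlgebra A] [PartialOrder A] : Set (A →ₚ[ℂ] ℂ) :=
  {φ | φ 1 = 1}

variable {A : Type u} {B : Type v} [CStarAlgebra A] [PartialOrder A]
  [CStarAlgebra B] [PartialOrder B]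

/-- The admissible couplings of `η` and `ξ`: the states `ω` of the maximal tensor product with
`ω (a ⊗ 1 + 1 ⊗ b) = η a + ξ b` for all `a` and `b`. -/
def couplings (η : A →ₚ[ℂ] ℂ) (ξ : B →ₚ[ℂ] ℂ) : Set (MaxTensorProduct A B →ₚ[ℂ] ℂ) :=
  {ω | ω ∈ stateSpace (MaxTensorProduct A B) ∧
    ∀ (a : A) (b : B), ω (tmul a 1 + tmul 1 b) = η a + ξ b}

/-- The admissible pairings for the cost `c`: the pairs of self-adjoint elements with
`a ⊗ 1 + 1 ⊗ b ≤ c`. -/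
def pairings (c : MaxTensorProduct A B) : Set (A × B) :=
  {p | IsSelfAdjoint p.1 ∧ IsSelfAdjoint p.2 ∧ tmul p.1 1 + tmul 1 p.2 ≤ c}

/-- The costs `ω c` of the admissible couplings. For a positive `c` these are nonnegative real
numbers, so that taking the real part only changes the type. -/
def couplingCosts (c : MaxTensorProduct A B) (η : A →ₚ[ℂ] ℂ) (ξ : B →ₚ[ℂ] ℂ) : Set ℝ :=
  {r | ∃ ω ∈ couplings η ξ, r = (ω c).re}

/-- The values `η a + ξ b` on the admissible pairings. For self-adjoint `a` and `b` these are real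
numbers, so that taking the real part only changes the type. -/
def pairingValues (c : MaxTensorProduct A B) (η : A →ₚ[ℂ] ℂ) (ξ : B →ₚ[ℂ] ℂ) : Set ℝ :=
  {r | ∃ p ∈ pairings c, r = (η p.1 + ξ p.2).re}

/-- The minimum optimal transport cost from `η` to `ξ`: the infimum of `ω c` over the admissible
couplings `ω`. -/
def transportCost (c : MaxTensorProduct A B) (η : A →ₚ[ℂ] ℂ) (ξ : B →ₚ[ℂ] ℂ) : ℝ :=
  sInf (couplingCosts c η ξ)

end Transport

end

end MaxTensor

/-!
The duality is the Hahn–Banach theorem for the ordered real vector space of self-adjoint elements of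
the maximal tensor product. On the subspace of the elements `a ⊗ 1 + 1 ⊗ b` the marginals prescribe
the value `η a + ξ b`, and the couplings are exactly the positive extensions of this functional.
Such extensions can take at `c` any value between the lower and the upper bounds given by the
elements of the subspace below and above `c`; the coupling taking the lower bound
(`exists_positive_extension_isLUB`, `MaxTensor.exists_coupling_isLUB`) has as its cost the supremum
over the pairings. Every coupling costs at least that much, since it is positive, so this coupling
is optimal.

What has to be known beforehand is that the prescribed functional is nonnegative on the nonnegative
elements of the subspace; this follows once a single coupling exists. The product state `η ⊗ ξ` is
one: on the algebraic tensor product it is the vector functional of the tensor product of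
the GNS representations of `η` and `ξ` (`MaxTensor.tensorRep`), hence it is bounded for the maximal
norm and extends to the completion (`MaxTensor.exists_product_functional`).
-/

/-! ### Positive extension of functionals -/

/-- An interpolating form of the Hahn–Banach theorem for ordered vector spaces: if the range of `T`
is cofinal and `ℓ` is nonnegative wherever `T` is, then `ℓ` factors through `T` by a positive
functional `g`, and `g c` can be given the smallest possible value, the supremum of `ℓ v` over
`T v ≤ c`. -/
theorem exists_positive_extension_isLUB {E V : Type*} [AddCommGroup E] [Module ℝ E]
    [PartialOrder E] [IsOrderedAddMonoid E] [PosSMulMono ℝ E] [AddCommGroup V] [Module ℝ V]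
    (T : V →ₗ[ℝ] E) (ℓ : V →ₗ[ℝ] ℝ) (hℓ : ∀ v, 0 ≤ T v → 0 ≤ ℓ v)
    (hT : ∀ e, ∃ v, e ≤ T v) (c : E) :
    ∃ g : E →ₗ[ℝ] ℝ, (∀ e, 0 ≤ e → 0 ≤ g e) ∧ (∀ v, g (T v) = ℓ v) ∧
      IsLUB {r | ∃ v, T v ≤ c ∧ r = ℓ v} (g c) := by
  -- The sublinear functional `N e = inf {ℓ v | e ≤ T v}` dominates every positive extension of `ℓ`,
  -- and conversely every linear functional below `N` is such an extension.
  let S : E → Set ℝ := fun e => {r | ∃ v, e ≤ T v ∧ r = ℓ v}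
  have hne (e : E) : (S e).Nonempty := (hT e).imp' ℓ fun v hv => ⟨v, hv, rfl⟩
  have hbdd (e : E) : BddBelow (S e) := by
    obtain ⟨w, hw⟩ := hT (-e)
    refine ⟨-ℓ w, ?_⟩
    rintro _ ⟨v, hv, rfl⟩
    have := hℓ (v + w) (by simpa using add_le_add hv hw)
    rw [map_add] at this
    linarith
  let N : E → ℝ := fun e => sInf (S e)
  have hN_le {e : E} {v : V} (h : e ≤ T v) : N e ≤ ℓ v := csInf_le (hbdd e) ⟨v, h, rfl⟩
  have hN_ge {e : E} {r : ℝ} (h : ∀ v, e ≤ T v → r ≤ ℓ v) : r ≤ N e :=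
    le_csInf (hne e) (by rintro _ ⟨v, hv, rfl⟩; exact h v hv)
  have hN_smul_le (t : ℝ) (ht : 0 < t) (e : E) : t * N e ≤ N (t • e) := by
    refine hN_ge fun v hv => ?_
    have h := smul_le_smul_of_nonneg_left hv (inv_nonneg.2 ht.le)
    rw [inv_smul_smul₀ ht.ne', ← map_smul] at h
    have := hN_le h
    rwa [map_smul, smul_eq_mul, ← div_eq_inv_mul, le_div_iff₀' ht] at this
  have hN_smul (t : ℝ) (ht : 0 < t) (e : E) : N (t • e) = t * N e := by
    refine le_antisymm ?_ (hN_smul_le t ht e)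
    have := hN_smul_le t⁻¹ (inv_pos.2 ht) (t • e)
    rwa [inv_smul_smul₀ ht.ne', ← div_eq_inv_mul, div_le_iff₀' ht] at this
  have hN_add (x y : E) : N (x + y) ≤ N x + N y := by
    refine sub_le_iff_le_add.1 (hN_ge fun v hv => sub_le_comm.1 (hN_ge fun w hw => ?_))
    have := hN_le (add_le_add hv hw |>.trans_eq (map_add T v w).symm)
    rw [map_add] at this
    linarith
  have hN_zero : N 0 = 0 :=
    le_antisymm (by simpa using hN_le (e := 0) (v := 0) (by simp)) (hN_ge hℓ)
  have hN_neg (t : ℝ) : t * N (-c) ≤ N (t • -c) := by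
    rcases lt_trichotomy t 0 with ht | rfl | ht
    · have h1 := hN_smul (-t) (neg_pos.2 ht) (-c)
      have h2 := hN_add ((-t) • -c) (t • -c)
      rw [← add_smul, neg_add_cancel, zero_smul, hN_zero] at h2
      linarith
    · simp [hN_zero]
    · exact (hN_smul t ht _).ge
  have hker (t : ℝ) (ht : t • -c = 0) : t • N (-c) = 0 := by
    have h1 := hN_neg t
    have h2 := hN_neg (-t)
    rw [neg_smul, ht] at h2
    rw [ht] at h1
    rw [neg_zero] at h2
    rw [hN_zero] at h1 h2
    rw [smul_eq_mul]; linarith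
  -- Prescribing the extreme value `N (-c)` at `-c` makes the supremum below equal to `g c`.
  let f : E →ₗ.[ℝ] ℝ := LinearPMap.mkSpanSingleton' (-c) (N (-c)) hker
  obtain ⟨g, hgf, hgN⟩ := exists_extension_of_le_sublinear f N hN_smul hN_add (by
    rintro ⟨x, hx⟩
    obtain ⟨t, rfl⟩ := Submodule.mem_span_singleton.1 hx
    exact (LinearPMap.mkSpanSingleton'_apply _ _ hker t hx).trans_le (hN_neg t))
  have hgc : g (-c) = N (-c) :=
    (hgf ⟨-c, Submodule.mem_span_singleton_self _⟩).trans
      (LinearPMap.mkSpanSingleton'_apply_self _ _ hker _)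
  refine ⟨g, fun e he => ?_, fun v => le_antisymm ((hgN _).trans (hN_le le_rfl)) ?_, ?_, ?_⟩
  · have := (hgN (-e)).trans (hN_le (v := 0) (by simpa using he))
    simpa using this
  · have := (hgN (T (-v))).trans (hN_le le_rfl)
    simpa using this
  · rintro _ ⟨v, hv, rfl⟩
    have := hN_le (e := -c) (v := -v) (by simpa using hv)
    rw [← hgc] at this
    simpa using this
  · intro b hb
    have : -b ≤ N (-c) := hN_ge fun v hv => by
      have := hb ⟨-v, by simpa using neg_le_neg hv, rfl⟩
      rw [map_neg] at this
      linarith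
    rw [← hgc, map_neg] at this
    linarith

/-- The complexification of a positive real functional on the self-adjoint part. -/
theorem selfAdjoint.exists_positiveLinearMap_extension {C : Type*} [CStarAlgebra C] [PartialOrder C]
    [StarOrderedRing C] (g : selfAdjoint C →ₗ[ℝ] ℝ) (hg : ∀ x, 0 ≤ x → 0 ≤ g x) :
    ∃ ω : C →ₚ[ℂ] ℂ, ∀ x : selfAdjoint C, ω x = g x := by
  let φ : C →ₗ[ℂ] ℂ := Module.Dual.extendRCLike (𝕜 := ℂ) (g ∘ₗ realPart)
  have hφ (x : selfAdjoint C) : φ x = g x := by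
    simp [φ, Module.Dual.extendRCLike_apply, realPart_I_smul]
  refine ⟨PositiveLinearMap.mk₀ φ fun x hx => ?_, hφ⟩
  rw [hφ ⟨x, hx.isSelfAdjoint⟩]
  exact_mod_cast hg _ hx

instance selfAdjoint.posSMulMono_real {C : Type*} [CStarAlgebra C] [PartialOrder C]
    [StarOrderedRing C] : PosSMulMono ℝ (selfAdjoint C) :=
  ⟨fun t ht x y hxy => by
    have h : t • (x : C) ≤ t • (y : C) := smul_le_smul_of_nonneg_left hxy ht
    exact h⟩

namespace MaxTensor

/-! ### Tensor products of representations -/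

section TensorRep
open ContinuousLinearMap UniformSpace

variable {H K : Type*} [NormedAddCommGroup H] [InnerProductSpace ℂ H]
  [NormedAddCommGroup K] [InnerProductSpace ℂ K]

/-- The Hilbert space tensor product: the completion of the algebraic tensor product. -/
abbrev HilbertTensor (H K : Type*) [NormedAddCommGroup H] [InnerProductSpace ℂ H]
    [NormedAddCommGroup K] [InnerProductSpace ℂ K] := Completion (H ⊗[ℂ] K)

/-- The bounded operator `S ⊗ T` on the Hilbert space tensor product. -/
noncomputable def hilbertTensorMap (S : H →L[ℂ] H) (T : K →L[ℂ] K) :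
    HilbertTensor H K →L[ℂ] HilbertTensor H K :=
  (TensorProduct.mapL S T).completion

theorem hilbertTensorMap_coe (S : H →L[ℂ] H) (T : K →L[ℂ] K) (x : H ⊗[ℂ] K) :
    hilbertTensorMap S T x = ((TensorProduct.mapL S T x : H ⊗[ℂ] K) : HilbertTensor H K) := by
  simp [hilbertTensorMap]

/-- Bounded operators on `HilbertTensor H K` agree if they agree on elementary tensors. -/
theorem HilbertTensor.ext_clm {X Y : HilbertTensor H K →L[ℂ] HilbertTensor H K}
    (h : ∀ (x : H) (y : K), X ((x ⊗ₜ[ℂ] y : H ⊗[ℂ] K) : HilbertTensor H K) =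
      Y ((x ⊗ₜ[ℂ] y : H ⊗[ℂ] K) : HilbertTensor H K)) : X = Y := by
  ext z
  induction z using Completion.induction_on with
  | hp => exact isClosed_eq X.continuous Y.continuous
  | ih z =>
    induction z with
    | zero => rw [Completion.coe_zero, map_zero, map_zero]
    | tmul x y => exact h x y
    | add z w hz hw => rw [Completion.coe_add, map_add, map_add, hz, hw]

theorem hilbertTensorMap_mul (S S' : H →L[ℂ] H) (T T' : K →L[ℂ] K) :
    hilbertTensorMap (S * S') (T * T') = hilbertTensorMap S T * hilbertTensorMap S' T' :=
  HilbertTensor.ext_clm fun x y => by simp [hilbertTensorMap_coe]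

theorem star_hilbertTensorMap [CompleteSpace H] [CompleteSpace K] (S : H →L[ℂ] H)
    (T : K →L[ℂ] K) : star (hilbertTensorMap S T) = hilbertTensorMap (star S) (star T) := by
  rw [star_eq_adjoint, eq_comm, eq_adjoint_iff]
  intro x y
  induction x, y using Completion.induction_on₂ with
  | hp => exact isClosed_eq (by fun_prop) (by fun_prop)
  | ih x y =>
    simp only [hilbertTensorMap_coe, Completion.inner_coe]
    induction x with
    | zero => simp
    | add x x' hx hx' => rw [map_add, inner_add_left, hx, hx', inner_add_left]
    | tmul a b =>
      induction y with
      | zero => simp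
      | add y y' hy hy' => rw [map_add, inner_add_right, hy, hy', inner_add_right]
      | tmul a' b' => simp [star_eq_adjoint, adjoint_inner_left]

variable {A B : Type*} [CStarAlgebra A] [CStarAlgebra B] [CompleteSpace H] [CompleteSpace K]
  (π : A →⋆ₐ[ℂ] (H →L[ℂ] H)) (ρ : B →⋆ₐ[ℂ] (K →L[ℂ] K))

/-- The algebra homomorphism `a ⊗ b ↦ π a ⊗ ρ b`. -/
noncomputable def tensorAlgHom :
    A ⊗[ℂ] B →ₐ[ℂ] (HilbertTensor H K →L[ℂ] HilbertTensor H K) :=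
  Algebra.TensorProduct.algHomOfLinearMapTensorProduct
    (TensorProduct.lift (LinearMap.mk₂ ℂ (fun a b => hilbertTensorMap (π a) (ρ b))
      (fun _ _ _ => HilbertTensor.ext_clm fun x y => by
        simp [hilbertTensorMap_coe, TensorProduct.add_tmul, Completion.coe_add])
      (fun _ _ _ => HilbertTensor.ext_clm fun x y => by
        simp [hilbertTensorMap_coe, ← TensorProduct.smul_tmul', Completion.coe_smul])
      (fun _ _ _ => HilbertTensor.ext_clm fun x y => by
        simp [hilbertTensorMap_coe, TensorProduct.tmul_add, Completion.coe_add])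
      (fun _ _ _ => HilbertTensor.ext_clm fun x y => by
        simp [hilbertTensorMap_coe, TensorProduct.tmul_smul, Completion.coe_smul])))
    (fun a a' b b' => by simp [hilbertTensorMap_mul])
    (HilbertTensor.ext_clm fun x y => by simp [hilbertTensorMap_coe])

theorem tensorAlgHom_tmul (a : A) (b : B) :
    tensorAlgHom π ρ (a ⊗ₜ b) = hilbertTensorMap (π a) (ρ b) := rfl

/-- The tensor product of the representations `π` and `ρ`, as a `*`-representation of the algebraic
tensor product. -/
noncomputable def tensorRep : A ⊗[ℂ] B →⋆ₐ[ℂ] (HilbertTensor H K →L[ℂ] HilbertTensor H K) :=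
  { tensorAlgHom π ρ with
    map_star' := fun z => by
      change tensorAlgHom π ρ (star z) = star (tensorAlgHom π ρ z)
      induction z with
      -- The zero and the sum that `star_zero` and `star_add` find on the operators agree with the
      -- ones in the goal only up to unfolding of the completion, so that rewriting misses them.
      | zero =>
        rw [star_zero, map_zero]
        exact (star_zero (HilbertTensor H K →L[ℂ] HilbertTensor H K)).symm
      | tmul a b =>
        simp only [TensorProduct.star_tmul, tensorAlgHom_tmul, star_hilbertTensorMap, map_star]
      | add z w hz hw =>
        rw [star_add, map_add, map_add, hz, hw]
        exact (star_add (R := HilbertTensor H K →L[ℂ] HilbertTensor H K) _ _).symm }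

theorem tensorRep_tmul (a : A) (b : B) :
    tensorRep π ρ (a ⊗ₜ b) = hilbertTensorMap (π a) (ρ b) := rfl

end TensorRep

/-! ### The product state -/

/-- The class of `1` is the GNS vector: it recovers the functional as a vector functional. -/
theorem inner_gnsStarAlgHom_apply {A : Type*} [CStarAlgebra A] [PartialOrder A]
    [StarOrderedRing A] (f : A →ₚ[ℂ] ℂ) (a : A) :
    inner ℂ (f.toPreGNS 1 : f.GNS) (f.gnsStarAlgHom a (f.toPreGNS 1 : f.GNS)) = f a := by
  simp [PositiveLinearMap.preGNS_inner_def]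

universe u v

/-- A vector functional of a `*`-representation is bounded for the maximal norm, so it extends to a
positive functional on the maximal tensor product. -/
theorem exists_vectorFunctional {A : Type u} {B : Type v} [CStarAlgebra A] [CStarAlgebra B]
    {H : Type (max u v)} [NormedAddCommGroup H] [InnerProductSpace ℂ H] [CompleteSpace H]
    (π : A ⊗[ℂ] B →⋆ₐ[ℂ] (H →L[ℂ] H)) (x₀ : H) :
    ∃ ω : MaxTensorProduct A B →ₚ[ℂ] ℂ, ∀ x, ω (ofAlg x) = inner ℂ x₀ (π x x₀) := by
  let φ : A ⊗[ℂ] B →ₗ[ℂ] ℂ :=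
    { toFun := fun x => inner ℂ x₀ (π x x₀)
      map_add' := fun x y => by
        rw [map_add, add_apply, inner_add_right]
      map_smul' := fun c x => by
        rw [map_smul, smul_apply, inner_smul_right]; rfl }
  let ψ : AlgTensor A B →L[ℂ] ℂ :=
    LinearMap.mkContinuous (E := AlgTensor A B) φ (‖x₀‖ * ‖x₀‖) fun x => by
      calc ‖inner ℂ x₀ (π x x₀)‖ ≤ ‖x₀‖ * (‖π x‖ * ‖x₀‖) :=
            (norm_inner_le_norm _ _).trans (by gcongr; exact (π x).le_opNorm x₀)
        _ ≤ ‖x₀‖ * (maxNorm x * ‖x₀‖) := by gcongr; exact norm_rep_le π x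
        _ = ‖x₀‖ * ‖x₀‖ * maxNorm x := by ring
  let Ψ : MaxTensorProduct A B →L[ℂ] ℂ := ψ.fromCompletion
  have hΨ (x : A ⊗[ℂ] B) : Ψ (ofAlg x) = inner ℂ x₀ (π x x₀) := ψ.fromCompletion_apply_coe x
  refine ⟨PositiveLinearMap.mk₀ (Ψ : MaxTensorProduct A B →ₗ[ℂ] ℂ) fun x hx => ?_, hΨ⟩
  obtain ⟨z, rfl⟩ := CStarAlgebra.nonneg_iff_eq_star_mul_self.1 hx
  clear hx
  change 0 ≤ Ψ (star z * z)
  induction z using induction_ofAlg with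
  | hp =>
    exact (isClosed_Ici (a := (0 : ℂ))).preimage
      (Ψ.continuous.comp (continuous_star_max.mul continuous_id))
  | h z =>
    rw [star_ofAlg, ← ofAlg_mul, hΨ, map_mul, map_star, ContinuousLinearMap.star_eq_adjoint,
      mul_apply_eq_comp, ContinuousLinearMap.adjoint_inner_right,
      inner_self_eq_norm_sq_to_K]
    exact pow_nonneg (RCLike.ofReal_nonneg.2 (norm_nonneg (π z x₀))) 2

variable {A : Type*} {B : Type*} [CStarAlgebra A] [PartialOrder A] [StarOrderedRing A]
    [CStarAlgebra B] [PartialOrder B] [StarOrderedRing B]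

/-- The product functional `η ⊗ ξ`, as the vector functional of the tensor product of the two GNS
representations at the tensor product of the GNS vectors. -/
theorem exists_product_functional (η : A →ₚ[ℂ] ℂ) (ξ : B →ₚ[ℂ] ℂ) :
    ∃ ω : MaxTensorProduct A B →ₚ[ℂ] ℂ, ∀ a b, ω (tmul a b) = η a * ξ b := by
  obtain ⟨ω, hω⟩ := exists_vectorFunctional (tensorRep η.gnsStarAlgHom ξ.gnsStarAlgHom)
    (((η.toPreGNS 1 : η.GNS) ⊗ₜ[ℂ] (ξ.toPreGNS 1 : ξ.GNS) : η.GNS ⊗[ℂ] ξ.GNS) :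
      HilbertTensor η.GNS ξ.GNS)
  refine ⟨ω, fun a b => ?_⟩
  rw [tmul, hω, tensorRep_tmul, hilbertTensorMap_coe, TensorProduct.mapL_tmul,
    UniformSpace.Completion.inner_coe, TensorProduct.inner_tmul, inner_gnsStarAlgHom_apply,
    inner_gnsStarAlgHom_apply]

theorem couplings_nonempty {η : A →ₚ[ℂ] ℂ} {ξ : B →ₚ[ℂ] ℂ} (hη : η ∈ stateSpace A)
    (hξ : ξ ∈ stateSpace B) : (couplings η ξ).Nonempty := by
  have hη1 : η 1 = 1 := hη
  have hξ1 : ξ 1 = 1 := hξ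
  obtain ⟨ω, hω⟩ := exists_product_functional η ξ
  refine ⟨ω, ?_, fun a b => by rw [map_add, hω, hω, hη1, hξ1, mul_one, one_mul]⟩
  change ω (tmul 1 1) = 1
  rw [hω, hη1, hξ1, one_mul]

/-! ### Duality -/

theorem ofAlg_zero {A B : Type*} [CStarAlgebra A] [CStarAlgebra B] :
    ofAlg (0 : A ⊗[ℂ] B) = 0 := rfl

theorem isSelfAdjoint_tmul_one_add_one_tmul {A B : Type*} [CStarAlgebra A] [CStarAlgebra B]
    {a : A} {b : B} (ha : IsSelfAdjoint a) (hb : IsSelfAdjoint b) :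
    IsSelfAdjoint (tmul a 1 + tmul 1 b) := by
  simp [IsSelfAdjoint, tmul, star_ofAlg, ha.star_eq, hb.star_eq]

/-- The real linear map `(a, b) ↦ a ⊗ 1 + 1 ⊗ b` on pairs of self-adjoint elements. -/
noncomputable def pairingMap (A B : Type*) [CStarAlgebra A] [CStarAlgebra B] :
    (selfAdjoint A × selfAdjoint B) →ₗ[ℝ] selfAdjoint (MaxTensorProduct A B) where
  toFun p := ⟨tmul (p.1 : A) 1 + tmul 1 (p.2 : B),
    isSelfAdjoint_tmul_one_add_one_tmul p.1.2 p.2.2⟩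
  map_add' p q := by
    ext
    simp [tmul, TensorProduct.add_tmul, TensorProduct.tmul_add, ofAlg_add]
    abel
  map_smul' t p := by
    ext
    simp only [tmul, ← Complex.coe_smul, Prod.smul_fst, Prod.smul_snd, selfAdjoint.val_smul,
      ← TensorProduct.smul_tmul', TensorProduct.tmul_smul, ofAlg_smul, RingHom.id_apply,
      smul_add]

/-- Strong duality: some coupling has as its cost the supremum of the values of the pairings. -/
theorem exists_coupling_isLUB (c : MaxTensorProduct A B) (hc : IsSelfAdjoint c)
    {η : A →ₚ[ℂ] ℂ} {ξ : B →ₚ[ℂ] ℂ} (hη : η ∈ stateSpace A) (hξ : ξ ∈ stateSpace B) :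
    ∃ ω ∈ couplings η ξ, ω c = ((ω c).re : ℂ) ∧ IsLUB (pairingValues c η ξ) (ω c).re := by
  have hη1 : η 1 = 1 := hη
  have hξ1 : ξ 1 = 1 := hξ
  let ℓ : (selfAdjoint A × selfAdjoint B) →ₗ[ℝ] ℝ :=
    { toFun := fun p => (η p.1 + ξ p.2).re
      map_add' := fun p q => by simp; ring
      map_smul' := fun t p => by simp; ring }
  obtain ⟨ω₀, -, hω₀⟩ := couplings_nonempty hη hξ
  obtain ⟨g, hg, hgℓ, hlub⟩ := exists_positive_extension_isLUB (pairingMap A B) ℓ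
    -- Evaluating any coupling shows that `η a + ξ b ≥ 0` whenever `a ⊗ 1 + 1 ⊗ b ≥ 0`.
    (fun p hp => by
      have h : 0 ≤ ω₀ (tmul (p.1 : A) 1 + tmul 1 (p.2 : B)) := ω₀.map_nonneg hp
      rw [hω₀] at h
      exact h.1)
    -- The multiples of the unit are cofinal.
    (fun x => ⟨((‖x‖ : ℝ) • 1, 0), by
      have h := IsSelfAdjoint.le_algebraMap_norm_self x.2
      have e : tmul ((((‖x‖ : ℝ) • 1 : selfAdjoint A) : A)) (1 : B) + tmul (1 : A) 0 =
          algebraMap ℝ _ ‖x‖ := by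
        simp [tmul, Algebra.algebraMap_eq_smul_one, ← Complex.coe_smul, ← TensorProduct.smul_tmul',
          ofAlg_smul, ofAlg_zero, ← ofAlg_one, Algebra.TensorProduct.one_def]
      exact h.trans_eq e.symm⟩) ⟨c, hc⟩
  obtain ⟨ω, hω⟩ := selfAdjoint.exists_positiveLinearMap_extension g hg
  have hωp (p : selfAdjoint A × selfAdjoint B) :
      ω (tmul (p.1 : A) 1 + tmul 1 (p.2 : B)) = η p.1 + ξ p.2 := by
    have hreal : ((η p.1 + ξ p.2).re : ℂ) = η p.1 + ξ p.2 := by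
      have h : IsSelfAdjoint (η p.1 + ξ p.2) := (p.1.2.map η).add (p.2.2.map ξ)
      exact Complex.conj_eq_iff_re.1 h
    rw [← hreal]
    refine (hω (pairingMap A B p)).trans ?_
    rw [hgℓ]
    rfl
  have hmarg (a : A) (b : B) : ω (tmul a 1 + tmul 1 b) = η a + ξ b := by
    have h : tmul a (1 : B) + tmul (1 : A) b = (tmul (realPart a : A) 1 + tmul 1 (realPart b : B)) +
        Complex.I • (tmul (imaginaryPart a : A) 1 + tmul 1 (imaginaryPart b : B)) := by
      conv_lhs => rw [← realPart_add_I_smul_imaginaryPart a, ← realPart_add_I_smul_imaginaryPart b]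
      simp only [tmul, TensorProduct.add_tmul, TensorProduct.tmul_add, ofAlg_add,
        ← TensorProduct.smul_tmul', TensorProduct.tmul_smul, ofAlg_smul, smul_add]
      abel
    rw [h, map_add, map_smul, hωp (realPart a, realPart b), hωp (imaginaryPart a, imaginaryPart b)]
    conv_rhs => rw [← realPart_add_I_smul_imaginaryPart a, ← realPart_add_I_smul_imaginaryPart b]
    simp only [map_add, map_smul, smul_add]
    abel
  have hone : ω 1 = 1 := by
    have h := hmarg 1 0
    simp only [tmul, TensorProduct.tmul_zero, map_zero, hη1, add_zero] at h
    rwa [ofAlg_zero, add_zero, ← Algebra.TensorProduct.one_def, ofAlg_one] at h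
  have hωc : ω c = (g ⟨c, hc⟩ : ℂ) := hω ⟨c, hc⟩
  refine ⟨ω, ⟨hone, hmarg⟩, by rw [hωc, Complex.ofReal_re], ?_⟩
  rw [hωc, Complex.ofReal_re]
  convert hlub using 1
  ext r
  constructor
  · rintro ⟨p, ⟨h1, h2, h⟩, rfl⟩
    exact ⟨(⟨p.1, h1⟩, ⟨p.2, h2⟩), h, rfl⟩
  · rintro ⟨p, h, rfl⟩
    exact ⟨(p.1, p.2), ⟨p.1.2, p.2.2, h⟩, rfl⟩

end MaxTensor

theorem mainTheorem6 {A : Type*} {B : Type*}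
    [CStarAlgebra A] [PartialOrder A] [StarOrderedRing A]
    [CStarAlgebra B] [PartialOrder B] [StarOrderedRing B]
    (c : MaxTensor.MaxTensorProduct A B) (hc : 0 ≤ c)
    (η : A →ₚ[ℂ] ℂ) (hη : η ∈ MaxTensor.stateSpace A)
    (ξ : B →ₚ[ℂ] ℂ) (hξ : ξ ∈ MaxTensor.stateSpace B) :
    (∃ ω ∈ MaxTensor.couplings η ξ, ω c = (MaxTensor.transportCost c η ξ : ℂ)) ∧
      IsGLB (MaxTensor.couplingCosts c η ξ) (MaxTensor.transportCost c η ξ) ∧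
      IsLUB (MaxTensor.pairingValues c η ξ) (MaxTensor.transportCost c η ξ) ∧
      MaxTensor.transportCost c η ξ = sSup (MaxTensor.pairingValues c η ξ) := by
  obtain ⟨ω, hω, hωc, hlub⟩ := MaxTensor.exists_coupling_isLUB c hc.isSelfAdjoint hη hξ
  -- Weak duality makes the cost of `ω` minimal among all couplings.
  have hleast : IsLeast (MaxTensor.couplingCosts c η ξ) (ω c).re := by
    refine ⟨⟨ω, hω, rfl⟩, ?_⟩
    rintro _ ⟨ω', hω', rfl⟩
    refine hlub.2 ?_
    rintro _ ⟨p, ⟨-, -, hp⟩, rfl⟩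
    rw [← hω'.2]
    exact (OrderHomClass.mono ω' hp).1
  have hcost : MaxTensor.transportCost c η ξ = (ω c).re := hleast.csInf_eq
  rw [hcost]
  exact ⟨⟨ω, hω, hωc⟩, hleast.isGLB, hlub, (hlub.csSup_eq hlub.nonempty).symm⟩
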